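/- For a finite graph $H$, a finite graph $G$ is called Ramsey for $H$ if every colouring of the edges of $G$ with two colours contains a monochromatic copy of $H$ (as a not necessarily induced subgraph), and the size Ramsey number $\hat r(H)$ is the minimum number of edges of a graph that is Ramsey for $H$. Let $K_{s,t}$ denote the complete bipartite graph with sides of orders $s$ and $t$. There is an absolute constant $c>0$ such that, for all integers $1\le s\le t$, \[ \hat r(K_{s,t}) \ \ge\ c\, s^{2-\frac st}\, t\, 2^s . \] Moreover, for all integers $s\ge 1$ and $t\ge s+2$, \[ \hat r(K_{s,t}) \ \ge\ \frac{s^{2-\frac st}\, t\, 2^s}{10000} . \] -/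

import Mathlib

/-- `G` is Ramsey for `H`: for every colouring of the edges of `G` with two colours, one of the two
colour classes contains a (not necessarily induced) copy of `H`. -/
def IsRamseyFor {V W : Type*} (G : SimpleGraph V) (H : SimpleGraph W) : Prop :=
  ∀ C : G.EdgeLabeling (Fin 2), ∃ k : Fin 2, H.IsContained (C.labelGraph k)

/-- The size Ramsey number of `H`: the minimum number of edges of a finite graph that is Ramsey
for `H`. (For finite `H` the minimum is over a nonempty set, by Ramsey's theorem.) -/
noncomputable def sizeRamsey {W : Type*} (H : SimpleGraph W) : ℕ :=
  sInf {m : ℕ | ∃ (n : ℕ) (G : SimpleGraph (Fin n)), IsRamseyFor G H ∧ G.edgeSet.ncard = m}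

open Finset

/-! ### Balanced random colourings of a finite set -/

/-! A random colouring is used whose colours are nearly balanced around each vertex. Each vertex
draws a random half-set that proposes colours for its edges, and each edge takes the proposal of a
random endpoint, its owner. Balance makes large monochromatic stars rarer: `j` prescribed edges of
equal colour at a vertex of degree `d` cost `2 ^ (-j)` times about `exp (-j² / (4d))`
(`card_filter_setColour_le`). In a copy of `K_{s,t}` a vertex of the `t`-side owns about `s / 2`
edges, so it gains a factor at most `min 1 (115 d / s²)`.

The expected number of monochromatic labelled copies is then at most twice a sum of products of
vertex weights. Choosing the `s`-side as neighbours of `s` of the vertices on the `t`-side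
(`sum_prod_adj_le`) bounds that sum by `(2m / 2^s)^t (115 / s²)^(t - s)`, with `m` the number of
edges. In a Ramsey graph every colouring has at least `s! t!` such copies, and `n! ≥ (n / e)^n`
finishes. -/

lemma choose_half_le (d j : ℕ) (hj : j ≤ d) :
    ((2 * d - j).choose d : ℝ) ≤
      (1 / 2) ^ j * Real.exp (-((j : ℝ) * (j - 1) / (4 * d))) * ((2 * d).choose d : ℝ) := by
  induction j with
  | zero => simp
  | succ j ih =>
    have hd : (0 : ℝ) < d := by exact_mod_cast (by omega : 0 < d)
    have hjd : (j : ℝ) + 1 ≤ d := by exact_mod_cast hj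
    have hrec : ((2 * d - (j + 1)).choose d : ℝ) * (2 * d - j) =
        ((2 * d - j).choose d : ℝ) * (d - j) := by
      have h := Nat.choose_mul_succ_eq (2 * d - (j + 1)) d
      rw [show 2 * d - (j + 1) + 1 = 2 * d - j by omega] at h
      have h' := congrArg (Nat.cast : ℕ → ℝ) h
      push_cast [Nat.cast_sub (show j ≤ 2 * d by omega),
        Nat.cast_sub (show d ≤ 2 * d - j by omega)] at h'
      rw [h']; ring
    have hpos : (0 : ℝ) < 2 * d - j := by linarith
    -- The ratio of consecutive binomials; multiplying these bounds sums the exponents `j / (2d)`.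
    have hratio : ((d : ℝ) - j) / (2 * d - j) ≤ 1 / 2 * Real.exp (-((j : ℝ) / (2 * d))) := by
      have h1 : 1 - (j : ℝ) / (2 * d) ≤ Real.exp (-((j : ℝ) / (2 * d))) := by
        have := Real.add_one_le_exp (-((j : ℝ) / (2 * d)))
        linarith
      have h2 : ((d : ℝ) - j) / (2 * d - j) ≤ 1 / 2 * (1 - (j : ℝ) / (2 * d)) := by
        rw [show 1 / 2 * (1 - (j : ℝ) / (2 * d)) = (2 * d - j) / (4 * d) by field_simp; ring,
          div_le_div_iff₀ hpos (by positivity)]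
        nlinarith [sq_nonneg (j : ℝ)]
      linarith
    have hexp : Real.exp (-(((j + 1 : ℕ) : ℝ) * (((j + 1 : ℕ) : ℝ) - 1) / (4 * d))) =
        Real.exp (-((j : ℝ) / (2 * d))) * Real.exp (-((j : ℝ) * (j - 1) / (4 * d))) := by
      rw [← Real.exp_add]
      congr 1
      push_cast
      field_simp
      ring
    calc ((2 * d - (j + 1)).choose d : ℝ)
        = ((d : ℝ) - j) / (2 * d - j) * ((2 * d - j).choose d : ℝ) := by
          rw [div_mul_eq_mul_div, eq_div_iff hpos.ne', hrec]; ring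
      _ ≤ (1 / 2 * Real.exp (-((j : ℝ) / (2 * d)))) *
          ((1 / 2) ^ j * Real.exp (-((j : ℝ) * (j - 1) / (4 * d))) * ((2 * d).choose d : ℝ)) :=
          mul_le_mul hratio (ih (by omega)) (by positivity) (by positivity)
      _ = _ := by rw [hexp]; ring

lemma card_filter_disjoint_powersetCard {α : Type*} [DecidableEq α] (d : ℕ) (X J : Finset α)
    (hJ : J ⊆ X) : #{A ∈ powersetCard d X | Disjoint J A} = (#X - #J).choose d := by
  rw [← card_sdiff_of_subset hJ, ← card_powersetCard]
  congr 1
  ext A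
  simp only [mem_filter, mem_powersetCard, subset_sdiff]
  grind

lemma card_filter_subset_powersetCard {α : Type*} [DecidableEq α] (d : ℕ) (X J : Finset α)
    (hX : #X = 2 * d) (hJ : J ⊆ X) :
    #{A ∈ powersetCard d X | J ⊆ A} = (#X - #J).choose d := by
  rw [← card_filter_disjoint_powersetCard d X J hJ]
  refine card_nbij' (X \ ·) (X \ ·) ?_ ?_ ?_ ?_
  · intro A hA
    simp only [coe_filter, mem_powersetCard, Set.mem_ofPred_eq] at hA ⊢
    refine ⟨⟨sdiff_subset, ?_⟩, ?_⟩
    · rw [card_sdiff_of_subset hA.1.1]; omega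
    · exact (disjoint_sdiff).mono_left hA.2
  · intro A hA
    simp only [coe_filter, mem_powersetCard, Set.mem_ofPred_eq] at hA ⊢
    refine ⟨⟨sdiff_subset, ?_⟩, ?_⟩
    · rw [card_sdiff_of_subset hA.1.1]; omega
    · exact subset_sdiff.2 ⟨hJ, hA.2⟩
  · intro A hA
    simp only [coe_filter, mem_powersetCard, Set.mem_ofPred_eq] at hA
    exact Finset.sdiff_sdiff_eq_self hA.1.1
  · intro A hA
    simp only [coe_filter, mem_powersetCard, Set.mem_ofPred_eq] at hA
    exact Finset.sdiff_sdiff_eq_self hA.1.1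

/-- The sets containing exactly half of the elements of `N × Bool`. Such a set `A` colours `u ∈ N`
according to whether `(u, true) ∈ A`. -/
def halfSets {V : Type*} (N : Finset V) : Finset (Finset (V × Bool)) :=
  powersetCard #N (N ×ˢ univ)

/-- The colour which a subset of `V × Bool` assigns to an element of `V`. -/
def setColour {V : Type*} [DecidableEq V] (A : Finset (V × Bool)) (u : V) : Bool :=
  decide ((u, true) ∈ A)

lemma halfSets_nonempty {V : Type*} (N : Finset V) : (halfSets N).Nonempty := by
  rw [halfSets, powersetCard_nonempty, card_product]
  exact Nat.le_mul_of_pos_right _ (by simp)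

/-- The two colours ask that `A` contain, respectively avoid, `J × {true}`; complementation gives
both the same count. Doubling `N` removes any parity condition on its size. -/
lemma card_filter_setColour_le {V : Type*} [DecidableEq V] (N J : Finset V) (hJ : J ⊆ N)
    (k : Bool) :
    (#{A ∈ halfSets N | ∀ u ∈ J, setColour A u = k} : ℝ) ≤
      (1 / 2) ^ #J * Real.exp (-((#J : ℝ) * (#J - 1) / (4 * #N))) * #(halfSets N) := by
  have hX : #(N ×ˢ (univ : Finset Bool)) = 2 * #N := by simp [mul_comm]
  have hsub : J ×ˢ {true} ⊆ N ×ˢ (univ : Finset Bool) := product_subset_product hJ (subset_univ _)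
  have hc : #(J ×ˢ ({true} : Finset Bool)) = #J := by simp
  have key : #{A ∈ halfSets N | ∀ u ∈ J, setColour A u = k} = (2 * #N - #J).choose #N := by
    cases k
    · rw [← hX, ← hc, ← card_filter_disjoint_powersetCard _ _ _ hsub]
      congr 1
      ext A
      simp only [halfSets, mem_filter, setColour, decide_eq_false_iff_not, disjoint_left,
        mem_product, mem_singleton]
      refine and_congr_right fun _ => ⟨fun h p hp => ?_, fun h u hu => h (a := (u, true)) ⟨hu, rfl⟩⟩
      have := h p.1 hp.1
      rwa [← hp.2] at this
    · rw [← hX, ← hc, ← card_filter_subset_powersetCard _ _ _ hX hsub]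
      congr 1
      ext A
      simp only [halfSets, mem_filter, setColour, decide_eq_true_eq, subset_iff,
        mem_product, mem_singleton]
      refine and_congr_right fun _ => ⟨fun h p hp => ?_, fun h u hu => h (x := (u, true)) ⟨hu, rfl⟩⟩
      have := h p.1 hp.1
      rwa [← hp.2] at this
  rw [key, halfSets, card_powersetCard, hX]
  exact choose_half_le _ _ (card_le_card hJ)

/-! ### The random colouring of the edges -/

/-- Independence of fair coins: the expectation of a product over distinct coordinates factorises.
-/
lemma sum_prod_comp_injOn {E P : Type*} [Fintype E] [DecidableEq E] (Q : Finset P) (e : P → E)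
    (he : Set.InjOn e Q) (g : P → Bool → ℝ) :
    ∑ o : E → Bool, ∏ p ∈ Q, g p (o (e p)) =
      2 ^ Fintype.card E * ∏ p ∈ Q, (g p true + g p false) / 2 := by
  have h1 (o : E → Bool) :
      ∏ p ∈ Q, g p (o (e p)) = ∏ x : E, ∏ p ∈ Q with e p = x, g p (o x) := by
    rw [← prod_fiberwise Q e]
    refine prod_congr rfl fun x _ => prod_congr rfl fun p hp => ?_
    rw [(mem_filter.1 hp).2]
  have h2 (x : E) : ∑ b : Bool, ∏ p ∈ Q with e p = x, g p b =
      2 * ∏ p ∈ Q with e p = x, (g p true + g p false) / 2 := by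
    have hc : #{p ∈ Q | e p = x} ≤ 1 := by
      refine card_le_one.2 fun p hp q hq => ?_
      rw [mem_filter] at hp hq
      exact he hp.1 hq.1 (hp.2.trans hq.2.symm)
    rcases Nat.le_one_iff_eq_zero_or_eq_one.1 hc with h | h
    · rw [card_eq_zero.1 h]; simp
    · obtain ⟨p, hp⟩ := card_eq_one.1 h
      rw [hp]; simp
      ring
  simp_rw [h1]
  rw [← Fintype.piFinset_univ,
    ← prod_univ_sum (fun _ => univ) fun x b => ∏ p ∈ Q with e p = x, g p b]
  simp_rw [h2]
  rw [prod_mul_distrib, prod_fiberwise]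
  simp

section Ownership

variable {V : Type*} [LinearOrder V]

/-- Whether the endpoint `v` owns the edge `s(u, v)`, if owners are chosen according to `o`. -/
def owns (o : Sym2 V → Bool) (v u : V) : Bool := xor (o s(u, v)) (decide (u < v))

lemma owns_swap (o : Sym2 V → Bool) {u v : V} (h : u ≠ v) : owns o u v = !owns o v u := by
  unfold owns
  rw [Sym2.eq_swap]
  rcases lt_or_gt_of_ne h with h | h <;> simp [h, h.not_gt]

/-- The colour which the owner of the edge `s(u, v)` assigns to it. -/
def ownerColour (o : Sym2 V → Bool) (f : V → Finset (V × Bool)) (u v : V) : Bool :=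
  if owns o v u then setColour (f v) u else setColour (f u) v

lemma ownerColour_swap (o : Sym2 V → Bool) (f : V → Finset (V × Bool)) {u v : V} (h : u ≠ v) :
    ownerColour o f v u = ownerColour o f u v := by
  unfold ownerColour
  rw [owns_swap o h]
  cases owns o v u <;> simp

/-- Each edge has exactly one owner. Hence the factors `1 / 2` multiply to exactly `(1 / 2) ^ (#S *
#T)`. -/
lemma card_filter_owns_add (o : Sym2 V → Bool) {S T : Finset V} (hST : Disjoint S T) :
    ∑ v ∈ T, #{u ∈ S | owns o v u} + ∑ u ∈ S, #{v ∈ T | owns o u v} = #S * #T := by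
  have h : ∑ u ∈ S, #{v ∈ T | owns o u v} = ∑ v ∈ T, #{u ∈ S | ¬ owns o v u} := by
    simp_rw [card_filter]
    rw [sum_comm]
    refine sum_congr rfl fun v hv => sum_congr rfl fun u hu => ?_
    rw [owns_swap o (disjoint_iff_ne.1 hST u hu v hv)]
    simp
  rw [h, ← sum_add_distrib]
  simp_rw [card_filter_add_card_filter_not]
  simp [mul_comm]

variable [Fintype V] (G : SimpleGraph V) [DecidableRel G.Adj]

/-- All choices of one half-set for the neighbourhood of each vertex. -/
def neighborHalfSets : Finset (V → Finset (V × Bool)) :=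
  Fintype.piFinset fun v => halfSets (G.neighborFinset v)

/-- With owners fixed, the condition splits into independent ones: each vertex `w` must be constant
on the set `J w` of edges of the copy that it owns. The gain from balance is kept only on `T`. -/
lemma card_filter_ownerColour_le {S T : Finset V} (hST : Disjoint S T)
    (hadj : ∀ u ∈ S, ∀ v ∈ T, G.Adj u v) (o : Sym2 V → Bool) (k : Bool) :
    (#{f ∈ neighborHalfSets G | ∀ u ∈ S, ∀ v ∈ T, ownerColour o f u v = k} : ℝ) ≤
      (1 / 2) ^ (#S * #T) *
        (∏ v ∈ T, Real.exp (-((#{u ∈ S | owns o v u} : ℝ) * (#{u ∈ S | owns o v u} - 1) /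
          (4 * G.degree v)))) * #(neighborHalfSets G) := by
  set J : V → Finset V := fun w =>
    if w ∈ T then {u ∈ S | owns o w u} else if w ∈ S then {v ∈ T | owns o w v} else ∅ with hJ
  have hJT {v} (hv : v ∈ T) : J v = {u ∈ S | owns o v u} := by simp [hJ, hv]
  have hJS {u} (hu : u ∈ S) : J u = {v ∈ T | owns o u v} := by
    simp [hJ, hu, disjoint_left.1 hST hu]
  have hJN (w : V) : J w ⊆ G.neighborFinset w := by
    intro x hx
    rw [SimpleGraph.mem_neighborFinset]
    by_cases hw : w ∈ T
    · rw [hJT hw, mem_filter] at hx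
      exact (hadj x hx.1 w hw).symm
    · by_cases hw' : w ∈ S
      · rw [hJS hw', mem_filter] at hx
        exact hadj w hw' x hx.1
      · simp [hJ, hw, hw'] at hx
  have hsum : ∑ w, #(J w) = #S * #T := by
    rw [← card_filter_owns_add o hST, add_comm, sum_congr (s₁ := T) rfl fun v hv => by rw [← hJT hv],
      sum_congr (s₁ := S) rfl fun u hu => by rw [← hJS hu], ← sum_union hST]
    refine (sum_subset (subset_univ _) fun w _ hw => ?_).symm
    rw [mem_union, not_or] at hw
    simp [hJ, hw]
  have hsub : {f ∈ neighborHalfSets G | ∀ u ∈ S, ∀ v ∈ T, ownerColour o f u v = k} ⊆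
      Fintype.piFinset fun w =>
        {A ∈ halfSets (G.neighborFinset w) | ∀ x ∈ J w, setColour A x = k} := by
    intro f hf
    rw [mem_filter, neighborHalfSets, Fintype.mem_piFinset] at hf
    rw [Fintype.mem_piFinset]
    intro w
    refine mem_filter.2 ⟨hf.1 w, fun x hx => ?_⟩
    by_cases hw : w ∈ T
    · rw [hJT hw, mem_filter] at hx
      have := hf.2 x hx.1 w hw
      rwa [ownerColour, if_pos hx.2] at this
    · by_cases hw' : w ∈ S
      · rw [hJS hw', mem_filter] at hx
        have := hf.2 w hw' x hx.1
        rwa [← ownerColour_swap o f (disjoint_iff_ne.1 hST w hw' x hx.1), ownerColour,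
          if_pos hx.2] at this
      · simp [hJ, hw, hw'] at hx
  calc (#{f ∈ neighborHalfSets G | ∀ u ∈ S, ∀ v ∈ T, ownerColour o f u v = k} : ℝ)
      ≤ #(Fintype.piFinset fun w =>
        {A ∈ halfSets (G.neighborFinset w) | ∀ x ∈ J w, setColour A x = k}) := by
        exact_mod_cast card_le_card hsub
    _ = ∏ w, (#{A ∈ halfSets (G.neighborFinset w) | ∀ x ∈ J w, setColour A x = k} : ℝ) := by
        rw [Fintype.card_piFinset]; push_cast; rfl
    _ ≤ ∏ w, ((1 / 2) ^ #(J w) * (if w ∈ T then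
          Real.exp (-((#(J w) : ℝ) * (#(J w) - 1) / (4 * G.degree w))) else 1) *
          #(halfSets (G.neighborFinset w))) := by
        refine prod_le_prod (fun _ _ => by positivity) fun w _ => ?_
        refine (le_of_eq ?_).trans ((card_filter_setColour_le _ _ (hJN w) k).trans ?_)
        · congr!
        rw [SimpleGraph.card_neighborFinset_eq_degree]
        gcongr
        split_ifs
        · rfl
        · rw [Real.exp_le_one_iff, neg_nonpos]
          refine div_nonneg ?_ (by positivity)
          rcases Nat.eq_zero_or_pos #(J w) with h | h
          · simp [h]
          · have : (1 : ℝ) ≤ #(J w) := by exact_mod_cast h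
            nlinarith
    _ = _ := by
        rw [prod_mul_distrib, prod_mul_distrib, prod_pow_eq_pow_sum, hsum, neighborHalfSets,
          Fintype.card_piFinset, prod_ite_mem, univ_inter]
        push_cast
        congr 2
        exact prod_congr rfl fun v hv => by rw [hJT hv]

/-- The factor gained by the balancedness of the colouring at a vertex of degree `d`. -/
noncomputable def balanceFactor (a s d : ℕ) : ℝ :=
  Real.exp ((a : ℝ) * (a + 1) / (4 * d)) * ((1 + Real.exp (-((a : ℝ) / (2 * d)))) / 2) ^ s

/-- No integer lies strictly between `a` and `a + 1`, so `(j - a) * (j - a - 1) ≥ 0`. This replaces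
the quadratic exponent by one linear in `j`, which factorises over edges. -/
lemma exp_neg_mul_sub_one_le (a j d : ℕ) :
    Real.exp (-((j : ℝ) * (j - 1) / (4 * d))) ≤
      Real.exp ((a : ℝ) * (a + 1) / (4 * d)) * Real.exp (-((a : ℝ) / (2 * d))) ^ j := by
  rw [← Real.exp_nat_mul, ← Real.exp_add, Real.exp_le_exp]
  have h : 0 ≤ ((j : ℝ) - a) * (j - a - 1) := by
    rcases le_or_gt j a with h | h
    · have : (j : ℝ) ≤ a := by exact_mod_cast h
      nlinarith
    · have : (a : ℝ) + 1 ≤ j := by exact_mod_cast h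
      nlinarith
  rcases Nat.eq_zero_or_pos d with rfl | hd
  · simp
  have hd' : (0 : ℝ) < d := by exact_mod_cast hd
  have : (a : ℝ) * (a + 1) / (4 * d) + j * -((a : ℝ) / (2 * d)) - -((j : ℝ) * (j - 1) / (4 * d)) =
      ((j : ℝ) - a) * (j - a - 1) / (4 * d) := by
    field_simp
    ring
  have h2 : 0 ≤ ((j : ℝ) - a) * (j - a - 1) / (4 * d) := by positivity
  linarith

lemma sum_prod_exp_owns_le {S T : Finset V} (hST : Disjoint S T) (d : V → ℕ) (a : ℕ) :
    ∑ o : Sym2 V → Bool, ∏ v ∈ T, Real.exp (-((#{u ∈ S | owns o v u} : ℝ) *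
        (#{u ∈ S | owns o v u} - 1) / (4 * d v))) ≤
      2 ^ Fintype.card (Sym2 V) * ∏ v ∈ T, balanceFactor a #S (d v) := by
  set g : V × V → Bool → ℝ := fun p b =>
    if xor b (decide (p.2 < p.1)) then Real.exp (-((a : ℝ) / (2 * d p.1))) else 1 with hg
  -- Disjointness of `S` and `T` makes different pairs different edges, hence independently owned.
  have hinj : Set.InjOn (fun p : V × V => s(p.2, p.1)) (T ×ˢ S : Finset (V × V)) := by
    rintro ⟨v, u⟩ hp ⟨v', u'⟩ hq h
    simp only [coe_product, Set.mem_prod, mem_coe] at hp hq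
    simp only [Sym2.eq_iff] at h
    rcases h with h | h
    · rw [h.1, h.2]
    · exact absurd h.1 (disjoint_iff_ne.1 hST u hp.2 v' hq.1)
  calc _ ≤ ∑ o : Sym2 V → Bool, (∏ v ∈ T, Real.exp ((a : ℝ) * (a + 1) / (4 * d v))) *
        ∏ p ∈ T ×ˢ S, g p (o s(p.2, p.1)) := by
        refine sum_le_sum fun o _ => ?_
        rw [prod_product, ← prod_mul_distrib]
        refine prod_le_prod (fun _ _ => by positivity) fun v _ => ?_
        refine (exp_neg_mul_sub_one_le a _ (d v)).trans_eq ?_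
        congr 1
        rw [← prod_const, prod_filter]
        rfl
    _ = _ := by
        rw [← mul_sum, sum_prod_comp_injOn _ _ hinj g, mul_left_comm, prod_product,
          ← prod_mul_distrib]
        congr 1
        refine prod_congr rfl fun v _ => ?_
        rw [balanceFactor, ← prod_const]
        congr 1
        refine prod_congr rfl fun u _ => ?_
        by_cases h : u < v <;> simp [hg, h, add_comm]

/-- The expected number of colourings that are constant on the edges between `S` and `T`. -/
lemma sum_card_filter_ownerColour_le {S T : Finset V} (hST : Disjoint S T)
    (hadj : ∀ u ∈ S, ∀ v ∈ T, G.Adj u v) (k : Bool) (a : ℕ) :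
    ∑ o : Sym2 V → Bool,
      (#{f ∈ neighborHalfSets G | ∀ u ∈ S, ∀ v ∈ T, ownerColour o f u v = k} : ℝ) ≤
      2 ^ Fintype.card (Sym2 V) * #(neighborHalfSets G) *
        ∏ v ∈ T, ((1 / 2) ^ #S * balanceFactor a #S (G.degree v)) := by
  refine (sum_le_sum fun o _ => card_filter_ownerColour_le G hST hadj o k).trans ?_
  rw [← sum_mul, ← mul_sum, prod_mul_distrib, prod_const, ← pow_mul]
  have := sum_prod_exp_owns_le hST (fun v => G.degree v) a
  calc _ ≤ (1 / 2 : ℝ) ^ (#S * #T) * (2 ^ Fintype.card (Sym2 V) *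
        ∏ v ∈ T, balanceFactor a #S (G.degree v)) * #(neighborHalfSets G) := by gcongr
    _ = _ := by ring

end Ownership

/-! ### Bounds for the balance factor and for numbers of copies -/

lemma one_add_exp_neg_half_le (x : ℝ) :
    (1 + Real.exp (-x)) / 2 ≤ Real.exp (-(x / 2) + x ^ 2 / 8) := by
  -- Centring the coin reduces the bound to `cosh z ≤ exp (z² / 2)`.
  have h : (1 + Real.exp (-x)) / 2 = Real.exp (-(x / 2)) * Real.cosh (x / 2) := by
    rw [Real.cosh_eq, mul_div_assoc', mul_add, ← Real.exp_add, ← Real.exp_add]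
    ring_nf
    simp [add_comm]
  rw [h, Real.exp_add]
  gcongr
  refine (Real.cosh_le_exp_half_sq _).trans_eq ?_
  ring_nf

lemma balanceFactor_nonneg (a s d : ℕ) : 0 ≤ balanceFactor a s d := by
  unfold balanceFactor
  positivity

lemma balanceFactor_le_exp {a s d : ℕ} (hs : 1 ≤ s) (hsd : s ≤ d) (ha : 3 * a ≤ s) :
    balanceFactor a s d ≤ Real.exp (-(7 * (a : ℝ) ^ 2 / (32 * d))) := by
  have hd : (0 : ℝ) < d := by exact_mod_cast hs.trans hsd
  have hsd' : (s : ℝ) ≤ d := by exact_mod_cast hsd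
  have ha' : 3 * (a : ℝ) ≤ s := by exact_mod_cast ha
  have haa : (a : ℝ) ≤ a ^ 2 := by exact_mod_cast Nat.le_self_pow two_ne_zero a
  have h0 : (0 : ℝ) ≤ a := by positivity
  calc balanceFactor a s d
      ≤ Real.exp ((a : ℝ) * (a + 1) / (4 * d)) *
        Real.exp (-((a : ℝ) / (2 * d) / 2) + ((a : ℝ) / (2 * d)) ^ 2 / 8) ^ s := by
        unfold balanceFactor
        gcongr
        exact one_add_exp_neg_half_le _
    _ ≤ _ := by
        rw [← Real.exp_nat_mul, ← Real.exp_add, Real.exp_le_exp]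
        have e : (a : ℝ) * (a + 1) / (4 * d) +
            s * (-((a : ℝ) / (2 * d) / 2) + ((a : ℝ) / (2 * d)) ^ 2 / 8) =
            (8 * a ^ 2 + 8 * a - 8 * s * a + a ^ 2 * (s / d)) / (32 * d) := by
          field_simp
          ring
        rw [e, ← neg_div]
        have hq : (s : ℝ) / d ≤ 1 := (div_le_one hd).2 hsd'
        gcongr
        -- By `a ≤ a²`, `3a ≤ s` and `s ≤ d`, the numerator is at most `8a² + 8a² - 24a² + a² =
        -- -7a²`.
        nlinarith [mul_le_mul_of_nonneg_left hq (sq_nonneg (a : ℝ)),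
          mul_le_mul_of_nonneg_right ha' h0]

lemma balanceFactor_le_one {a s d : ℕ} (hs : 1 ≤ s) (hsd : s ≤ d) (ha : 3 * a ≤ s) :
    balanceFactor a s d ≤ 1 := by
  refine (balanceFactor_le_exp hs hsd ha).trans ?_
  rw [Real.exp_le_one_iff, neg_nonpos]
  positivity

lemma balanceFactor_le_div {s d : ℕ} (hs : 1 ≤ s) (hsd : s ≤ d) :
    balanceFactor (s / 3) s d ≤ 115 / (s : ℝ) ^ 2 * d := by
  have hd : (0 : ℝ) < d := by exact_mod_cast hs.trans hsd
  have hs' : (0 : ℝ) < s := by exact_mod_cast hs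
  have hsd' : (s : ℝ) ≤ d := by exact_mod_cast hsd
  have ha : 3 * (s / 3) ≤ s := Nat.mul_div_le s 3
  rw [div_mul_eq_mul_div, le_div_iff₀ (by positivity)]
  rcases Nat.eq_zero_or_pos (s / 3) with h | h
  · have h2 : (s : ℝ) ≤ 2 := by exact_mod_cast (by omega : s ≤ 2)
    nlinarith [balanceFactor_le_one hs hsd ha, balanceFactor_nonneg (s / 3) s d,
      mul_le_mul_of_nonneg_right (balanceFactor_le_one hs hsd ha) (sq_nonneg (s : ℝ))]
  · set a := s / 3
    have h5 : (s : ℝ) ≤ 5 * a := by exact_mod_cast (by omega : s ≤ 5 * a)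
    have ha0 : (0 : ℝ) < a := by exact_mod_cast h
    set y : ℝ := 7 * (a : ℝ) ^ 2 / (32 * d) with hy
    have hy0 : 0 < y := by positivity
    have h1 : Real.exp (-y) * y ≤ 1 := by
      rw [Real.exp_neg, inv_mul_le_one₀ (Real.exp_pos y)]
      linarith [Real.add_one_le_exp y]
    -- The source of 115: `s² ≤ 25a²` and `115 * 7 / 32 > 25`.
    have h2 : (s : ℝ) ^ 2 ≤ 115 * d * y := by
      have : 115 * d * y = 115 * 7 / 32 * (a : ℝ) ^ 2 := by rw [hy]; field_simp
      rw [this]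
      nlinarith
    calc balanceFactor a s d * (s : ℝ) ^ 2 ≤ Real.exp (-y) * (115 * d * y) := by
          gcongr
          exact balanceFactor_le_exp hs hsd ha
      _ = 115 * d * (Real.exp (-y) * y) := by ring
      _ ≤ 115 * d := mul_le_of_le_one_right (by positivity) h1

section Copies

variable {V : Type*} [Fintype V]

/-- Of all adjacencies only `x i ~ y i` for `i < s` is kept. Each of these `s` vertices `y i` then
pays its degree, and the other `r` pay nothing. -/
lemma sum_prod_adj_le [DecidableEq V] (G : SimpleGraph V) [DecidableRel G.Adj] (s r : ℕ)
    (w : V → ℝ) (hw : ∀ v, 0 ≤ w v) :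
    ∑ y : Fin (s + r) → V, ∑ x : Fin s → V with ∀ i j, G.Adj (x i) (y j), ∏ j, w (y j) ≤
      (∑ v, G.degree v * w v) ^ s * (∑ v, w v) ^ r := by
  set h : Fin (s + r) → V → ℝ := fun j v =>
    Fin.addCases (fun _ => G.degree v * w v) (fun _ => w v) j with hh
  calc _ ≤ ∑ y : Fin (s + r) → V,
        ∑ x ∈ Fintype.piFinset fun i => G.neighborFinset (y (Fin.castAdd r i)), ∏ j, w (y j) := by
        refine sum_le_sum fun y _ => sum_le_sum_of_subset_of_nonneg ?_
          fun _ _ _ => prod_nonneg fun _ _ => hw _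
        intro x hx
        rw [mem_filter] at hx
        rw [Fintype.mem_piFinset]
        intro i
        rw [SimpleGraph.mem_neighborFinset]
        exact (hx.2 i _).symm
    _ = ∑ y : Fin (s + r) → V, ∏ j, h j (y j) := by
        refine sum_congr rfl fun y _ => ?_
        rw [sum_const, Fintype.card_piFinset, nsmul_eq_mul, Fin.prod_univ_add, Fin.prod_univ_add,
          ← mul_assoc]
        push_cast
        rw [← prod_mul_distrib]
        simp [hh]
    _ = ∏ j, ∑ v, h j v := by
        rw [prod_univ_sum, Fintype.piFinset_univ]
    _ = _ := by
        rw [Fin.prod_univ_add]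
        simp [hh]

lemma factorial_mul_factorial_le_card {s t : ℕ}
    (Q : (Fin s → V) → (Fin t → V) → Prop) [∀ x y, Decidable (Q x y)]
    (x : Fin s → V) (y : Fin t → V) (hx : Function.Injective x) (hy : Function.Injective y)
    (hQ : ∀ (σ : Equiv.Perm (Fin s)) (τ : Equiv.Perm (Fin t)), Q (x ∘ σ) (y ∘ τ)) :
    s.factorial * t.factorial ≤
      #{p : (Fin t → V) × (Fin s → V) | Q p.2 p.1} := by
  have hc : #(univ : Finset (Equiv.Perm (Fin s) × Equiv.Perm (Fin t))) =
      s.factorial * t.factorial := by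
    rw [card_univ, Fintype.card_prod, Fintype.card_perm, Fintype.card_perm, Fintype.card_fin,
      Fintype.card_fin]
  rw [← hc]
  refine card_le_card_of_injOn (fun q => (y ∘ q.2, x ∘ q.1)) (fun q _ => ?_) ?_
  · simpa using hQ q.1 q.2
  · rintro ⟨σ, τ⟩ - ⟨σ', τ'⟩ - h
    simp only [Prod.mk.injEq] at h ⊢
    exact ⟨Equiv.ext fun i => hx (congrFun h.2 i), Equiv.ext fun i => hy (congrFun h.1 i)⟩

end Copies

/-! ### Labelled copies and the colouring by owners -/

section LabelledCopies

variable {V : Type*}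

/-- The labelled copies of `K_{s,t}` in `G`. -/
def IsLabelledCopy (G : SimpleGraph V) {s t : ℕ} (x : Fin s → V) (y : Fin t → V) : Prop :=
  Function.Injective x ∧ Function.Injective y ∧ ∀ i j, G.Adj (x i) (y j)

variable [LinearOrder V]

/-- The edge labelling in which each edge has the colour chosen by its owner. -/
def ownerLabeling (G : SimpleGraph V) (o : Sym2 V → Bool) (f : V → Finset (V × Bool)) :
    G.EdgeLabeling (Fin 2) :=
  SimpleGraph.EdgeLabeling.mk (fun u v _ => if ownerColour o f u v then 1 else 0)
    fun u v h => by rw [ownerColour_swap o f h.ne]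

lemma IsRamseyFor.exists_mono {s t : ℕ} {G : SimpleGraph V}
    (hG : IsRamseyFor G (completeBipartiteGraph (Fin s) (Fin t)))
    (o : Sym2 V → Bool) (f : V → Finset (V × Bool)) :
    ∃ (k : Bool) (x : Fin s → V) (y : Fin t → V), IsLabelledCopy G x y ∧
      ∀ i j, ownerColour o f (x i) (y j) = k := by
  obtain ⟨k, ⟨φ⟩⟩ := hG (ownerLabeling G o f)
  have hadj (i j) : ((ownerLabeling G o f).labelGraph k).Adj (φ (Sum.inl i)) (φ (Sum.inr j)) :=
    φ.toHom.map_adj (by simp)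
  refine ⟨decide (k = 1), fun i => φ (Sum.inl i), fun j => φ (Sum.inr j), ⟨?_, ?_, ?_⟩, ?_⟩
  · exact fun i j h => Sum.inl_injective (φ.injective h)
  · exact fun i j h => Sum.inr_injective (φ.injective h)
  · exact fun i j => (ownerLabeling G o f).labelGraph_le (hadj i j)
  · intro i j
    obtain ⟨h, hk⟩ := (SimpleGraph.EdgeLabeling.labelGraph_adj _ _).1 (hadj i j)
    change (if _ then (1 : Fin 2) else 0) = k at hk
    split_ifs at hk with hc <;> simp [hc, ← hk]

end LabelledCopies

/-! ### Vertex weights and the first-moment bound -/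

section Weights

variable {V : Type*} [Fintype V] (G : SimpleGraph V) [DecidableRel G.Adj]

/-- The weight of a vertex as a member of the larger side of a copy of `K_{s,t}`. -/
noncomputable def vertexWeight (s : ℕ) (v : V) : ℝ :=
  if s ≤ G.degree v then (1 / 2) ^ s * balanceFactor (s / 3) s (G.degree v) else 0

lemma vertexWeight_nonneg (s : ℕ) (v : V) : 0 ≤ vertexWeight G s v := by
  unfold vertexWeight
  split_ifs
  · have := balanceFactor_nonneg (s / 3) s (G.degree v)
    positivity
  · rfl

lemma sum_degree_mul_vertexWeight_le {s : ℕ} (hs : 1 ≤ s) :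
    ∑ v, G.degree v * vertexWeight G s v ≤ 2 * #G.edgeFinset / 2 ^ s := by
  have h : (2 * #G.edgeFinset : ℝ) = ∑ v, (G.degree v : ℝ) := by
    exact_mod_cast G.sum_degrees_eq_twice_card_edges.symm
  rw [h, sum_div]
  refine sum_le_sum fun v _ => ?_
  rw [div_eq_mul_inv, ← one_div, ← one_div_pow]
  gcongr
  unfold vertexWeight
  split_ifs with hv
  · exact mul_le_of_le_one_right (by positivity)
      (balanceFactor_le_one hs hv (Nat.mul_div_le s 3))
  · positivity

/-- With no degree factor in the sum, the bound `115 d / s²` on the balance factor supplies one, so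
the sum is again controlled by the number of edges. -/
lemma sum_vertexWeight_le {s : ℕ} (hs : 1 ≤ s) :
    ∑ v, vertexWeight G s v ≤ 2 * #G.edgeFinset / 2 ^ s * (115 / (s : ℝ) ^ 2) := by
  have h : (2 * #G.edgeFinset : ℝ) = ∑ v, (G.degree v : ℝ) := by
    exact_mod_cast G.sum_degrees_eq_twice_card_edges.symm
  rw [h, sum_div, sum_mul]
  refine sum_le_sum fun v _ => ?_
  rw [div_eq_mul_inv, ← one_div, ← one_div_pow]
  unfold vertexWeight
  split_ifs with hv
  · calc _ ≤ (1 / 2 : ℝ) ^ s * (115 / (s : ℝ) ^ 2 * G.degree v) := by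
          gcongr
          exact balanceFactor_le_div hs hv
      _ = _ := by ring
  · positivity

variable [LinearOrder V]

lemma sum_card_filter_mono_le {s t : ℕ} {x : Fin s → V} {y : Fin t → V}
    (hxy : IsLabelledCopy G x y) (k : Bool) :
    ∑ o : Sym2 V → Bool,
      (#{f ∈ neighborHalfSets G | ∀ i j, ownerColour o f (x i) (y j) = k} : ℝ) ≤
      2 ^ Fintype.card (Sym2 V) * #(neighborHalfSets G) * ∏ j, vertexWeight G s (y j) := by
  obtain ⟨hx, hy, hadj⟩ := hxy
  have hdisj : Disjoint (univ.image x) (univ.image y) := by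
    rw [disjoint_iff_ne]
    intro a ha b hb
    obtain ⟨i, -, rfl⟩ := mem_image.1 ha
    obtain ⟨j, -, rfl⟩ := mem_image.1 hb
    exact (hadj i j).ne
  have hcard : #(univ.image x) = s := by rw [card_image_of_injective _ hx, card_fin]
  -- The degree cutoff in `vertexWeight` thus loses no copy.
  have hdeg (j) : s ≤ G.degree (y j) := by
    rw [← hcard, ← G.card_neighborFinset_eq_degree]
    refine card_le_card fun a ha => ?_
    obtain ⟨i, -, rfl⟩ := mem_image.1 ha
    exact (G.mem_neighborFinset _ _).2 (hadj i j).symm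
  have h := sum_card_filter_ownerColour_le G hdisj (by simpa using hadj) k (s / 3)
  rw [prod_image hy.injOn, hcard] at h
  simp only [mem_image, mem_univ, true_and, forall_exists_index, forall_apply_eq_imp_iff] at h
  refine h.trans_eq ?_
  congr 1
  exact prod_congr rfl fun j _ => by rw [vertexWeight, if_pos (hdeg j)]

open Classical in
-- Double counting of pairs of a random choice and a monochromatic labelled copy: permuting each
-- side of one copy gives `s! t!` of them, and the factor 2 counts the colours.
lemma IsRamseyFor.factorial_mul_factorial_le {s t : ℕ} {G : SimpleGraph V} [DecidableRel G.Adj]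
    (hG : IsRamseyFor G (completeBipartiteGraph (Fin s) (Fin t))) :
    (s.factorial * t.factorial : ℝ) ≤
      2 * ∑ y : Fin t → V, ∑ x : Fin s → V with ∀ i j, G.Adj (x i) (y j),
        ∏ j, vertexWeight G s (y j) := by
  set Ω := neighborHalfSets G with hΩ
  set W := ∑ y : Fin t → V, ∑ x : Fin s → V with ∀ i j, G.Adj (x i) (y j),
    ∏ j, vertexWeight G s (y j) with hW
  set copies : Finset ((Fin t → V) × (Fin s → V)) := {p | IsLabelledCopy G p.2 p.1} with hcopies
  have hΩpos : (0 : ℝ) < #Ω := by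
    have : Ω.Nonempty := Fintype.piFinset_nonempty.2 fun v => halfSets_nonempty _
    exact_mod_cast this.card_pos
  have hlower (o : Sym2 V → Bool) (f : V → Finset (V × Bool)) :
      (s.factorial * t.factorial : ℝ) ≤
        ∑ k : Bool, ∑ p ∈ copies, if ∀ i j, ownerColour o f (p.2 i) (p.1 j) = k then 1 else 0 := by
    obtain ⟨k, x, y, hxy, hmono⟩ := hG.exists_mono o f
    have h := factorial_mul_factorial_le_card
      (fun x y => IsLabelledCopy G x y ∧ ∀ i j, ownerColour o f (x i) (y j) = k)
      x y hxy.1 hxy.2.1 fun σ τ => ⟨⟨hxy.1.comp σ.injective, hxy.2.1.comp τ.injective,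
        fun i j => hxy.2.2 _ _⟩, fun i j => hmono _ _⟩
    rw [← filter_filter, ← hcopies] at h
    refine le_trans ?_ (single_le_sum (fun _ _ => sum_nonneg fun _ _ => by positivity)
      (mem_univ k))
    rw [sum_boole]
    exact_mod_cast h
  have hupper (k : Bool) : ∑ p ∈ copies, ∑ o : Sym2 V → Bool, ∑ f ∈ Ω,
      (if ∀ i j, ownerColour o f (p.2 i) (p.1 j) = k then (1 : ℝ) else 0) ≤
        2 ^ Fintype.card (Sym2 V) * #Ω * W := by
    calc _ ≤ ∑ p ∈ copies, 2 ^ Fintype.card (Sym2 V) * #Ω * ∏ j, vertexWeight G s (p.1 j) := by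
          refine sum_le_sum fun p hp => ?_
          simp_rw [sum_boole]
          refine le_trans (le_of_eq ?_) (sum_card_filter_mono_le G (mem_filter.1 hp).2 k)
          congr!
      _ ≤ ∑ p : (Fin t → V) × (Fin s → V) with ∀ i j, G.Adj (p.2 i) (p.1 j),
          2 ^ Fintype.card (Sym2 V) * #Ω * ∏ j, vertexWeight G s (p.1 j) := by
          refine sum_le_sum_of_subset_of_nonneg
            (monotone_filter_right _ fun p _ hp => hp.2.2) fun p _ _ => ?_
          have := prod_nonneg fun j (_ : j ∈ univ) => vertexWeight_nonneg G s (p.1 j)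
          positivity
      _ = _ := by
          rw [← mul_sum, hW, sum_filter, Fintype.sum_prod_type]
          simp_rw [sum_filter]
  have htotal : (2 ^ Fintype.card (Sym2 V) * #Ω : ℝ) * (s.factorial * t.factorial) ≤
      2 ^ Fintype.card (Sym2 V) * #Ω * (2 * W) := by
    calc _ = ∑ o : Sym2 V → Bool, ∑ f ∈ Ω, (s.factorial * t.factorial : ℝ) := by
          simp [mul_assoc]
      _ ≤ ∑ o : Sym2 V → Bool, ∑ f ∈ Ω, ∑ k : Bool, ∑ p ∈ copies,
          (if ∀ i j, ownerColour o f (p.2 i) (p.1 j) = k then (1 : ℝ) else 0) :=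
          sum_le_sum fun o _ => sum_le_sum fun f _ => hlower o f
      _ = ∑ k : Bool, ∑ p ∈ copies, ∑ o : Sym2 V → Bool, ∑ f ∈ Ω,
          (if ∀ i j, ownerColour o f (p.2 i) (p.1 j) = k then (1 : ℝ) else 0) := by
          simp_rw [sum_comm (s := Ω)]
          rw [sum_comm]
          exact sum_congr rfl fun k _ => sum_comm
      _ ≤ ∑ k : Bool, 2 ^ Fintype.card (Sym2 V) * #Ω * W := sum_le_sum fun k _ => hupper k
      _ = _ := by simp; ring
  exact le_of_mul_le_mul_left htotal (by positivity)

end Weights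

/-- A graph with `m` edges that is Ramsey for `K_{s,t}` satisfies
`s! t! ≤ 2 (2m / 2 ^ s) ^ t (115 / s ^ 2) ^ (t - s)`. -/
lemma IsRamseyFor.factorial_mul_factorial_le_pow {n s r : ℕ} (hs : 1 ≤ s)
    {G : SimpleGraph (Fin n)}
    (hG : IsRamseyFor G (completeBipartiteGraph (Fin s) (Fin (s + r)))) :
    (s.factorial * (s + r).factorial : ℝ) ≤
      2 * ((2 * G.edgeSet.ncard / 2 ^ s) ^ (s + r) * (115 / (s : ℝ) ^ 2) ^ r) := by
  classical
  have hm : G.edgeSet.ncard = #G.edgeFinset := by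
    rw [← SimpleGraph.coe_edgeFinset, Set.ncard_coe_finset]
  have h1 := hG.factorial_mul_factorial_le
  have h2 := sum_prod_adj_le G s r _ (vertexWeight_nonneg G s)
  have h3 := sum_degree_mul_vertexWeight_le G hs
  have h4 := sum_vertexWeight_le G hs
  have h5 : 0 ≤ ∑ v, G.degree v * vertexWeight G s v :=
    sum_nonneg fun v _ => mul_nonneg (by positivity) (vertexWeight_nonneg G s v)
  have h6 : 0 ≤ ∑ v, vertexWeight G s v := sum_nonneg fun v _ => vertexWeight_nonneg G s v
  calc (s.factorial * (s + r).factorial : ℝ) ≤ _ := h1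
    _ ≤ 2 * ((∑ v, G.degree v * vertexWeight G s v) ^ s * (∑ v, vertexWeight G s v) ^ r) := by
        gcongr
    _ ≤ 2 * ((2 * #G.edgeFinset / 2 ^ s) ^ s *
          (2 * #G.edgeFinset / 2 ^ s * (115 / (s : ℝ) ^ 2)) ^ r) := by gcongr
    _ = _ := by rw [hm, mul_pow, pow_add]; ring

/-! ### Existence of Ramsey graphs -/

/-- Pigeonhole twice: `t` of the `N` vertices see the same colour pattern on the first `2 * s`
vertices, and some colour occurs `s` times in that pattern. -/
lemma exists_isRamseyFor_completeBipartiteGraph (s t : ℕ) :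
    ∃ n : ℕ, IsRamseyFor (⊤ : SimpleGraph (Fin n)) (completeBipartiteGraph (Fin s) (Fin t)) := by
  set N := Fintype.card (Fin (2 * s) → Fin 2) * t with hN
  refine ⟨2 * s + N, fun C => ?_⟩
  have hne (i : Fin (2 * s)) (j : Fin N) : Fin.castAdd N i ≠ Fin.natAdd (2 * s) j := by
    rw [Ne, Fin.ext_iff, Fin.val_castAdd, Fin.val_natAdd]
    omega
  obtain ⟨g, hg⟩ := Fintype.exists_le_card_fiber_of_mul_le_card
    (fun (j : Fin N) (i : Fin (2 * s)) => C.get (Fin.castAdd N i) (Fin.natAdd (2 * s) j) (hne i j))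
    (n := t) (by rw [Fintype.card_fin])
  obtain ⟨k, hk⟩ := Fintype.exists_le_card_fiber_of_mul_le_card g (n := s) (by simp)
  obtain ⟨x⟩ : Nonempty (Fin s ↪ {i // g i = k}) := by
    refine Function.Embedding.nonempty_of_card_le ?_
    rwa [Fintype.card_fin, Fintype.card_subtype]
  obtain ⟨y⟩ : Nonempty (Fin t ↪ {j : Fin N // (fun i =>
      C.get (Fin.castAdd N i) (Fin.natAdd (2 * s) j) (hne i j)) = g}) := by
    refine Function.Embedding.nonempty_of_card_le ?_
    rwa [Fintype.card_fin, Fintype.card_subtype]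
  have hadj (i j) : (C.labelGraph k).Adj (Fin.castAdd N (x i).1) (Fin.natAdd (2 * s) (y j).1) :=
    (SimpleGraph.EdgeLabeling.labelGraph_adj _ _).2
      ⟨hne _ _, (congrFun (y j).2 (x i).1).trans (x i).2⟩
  refine ⟨k, ⟨⟨⟨Sum.elim (fun i => Fin.castAdd N (x i).1) fun j => Fin.natAdd (2 * s) (y j).1,
    ?_⟩, ?_⟩⟩⟩
  · rintro (i | i) (j | j) h
    · simp at h
    · exact hadj i j
    · exact (hadj j i).symm
    · simp at h
  · refine Function.Injective.sumElim ?_ ?_ fun i j => hne _ _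
    · exact fun i j h => x.injective (Subtype.ext (Fin.castAdd_injective _ _ h))
    · exact fun i j h => y.injective (Subtype.ext (Fin.natAdd_injective _ _ h))

/-- Attainment matters because `sInf ∅ = 0` in `ℕ` would defeat any positive lower bound. -/
lemma exists_isRamseyFor_ncard_eq_sizeRamsey (s t : ℕ) :
    ∃ (n : ℕ) (G : SimpleGraph (Fin n)),
      IsRamseyFor G (completeBipartiteGraph (Fin s) (Fin t)) ∧
        G.edgeSet.ncard = sizeRamsey (completeBipartiteGraph (Fin s) (Fin t)) := by
  obtain ⟨n, hn⟩ := exists_isRamseyFor_completeBipartiteGraph s t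
  exact Nat.sInf_mem (s := {m : ℕ | ∃ (n : ℕ) (G : SimpleGraph (Fin n)),
    IsRamseyFor G (completeBipartiteGraph (Fin s) (Fin t)) ∧ G.edgeSet.ncard = m})
    ⟨_, n, ⊤, hn, rfl⟩

/-! ### The lower bound -/

lemma pow_self_le_exp_mul_factorial (n : ℕ) :
    (n : ℝ) ^ n ≤ Real.exp 1 ^ n * n.factorial := by
  rw [← Real.exp_nat_mul, mul_one, ← div_le_iff₀ (by positivity)]
  exact Real.pow_div_factorial_le_exp _ (by positivity) n

theorem le_sizeRamsey_completeBipartiteGraph (s t : ℕ) (hs : 1 ≤ s) (hst : s ≤ t) :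
    (s : ℝ) ^ (2 - (s : ℝ) / (t : ℝ)) * (t : ℝ) * (2 : ℝ) ^ s / 10000 ≤
      (sizeRamsey (completeBipartiteGraph (Fin s) (Fin t)) : ℝ) := by
  obtain ⟨n, G, hG, hm⟩ := exists_isRamseyFor_ncard_eq_sizeRamsey s t
  rw [← hm]
  by_contra! hlt
  obtain ⟨r, rfl⟩ := Nat.exists_eq_add_of_le hst
  have key := hG.factorial_mul_factorial_le_pow hs
  set t := s + r with ht
  set m : ℝ := (G.edgeSet.ncard : ℝ)
  have hs0 : (0 : ℝ) < s := by exact_mod_cast hs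
  have ht0 : (0 : ℝ) < t := by exact_mod_cast hs.trans hst
  -- The exponent `2 - s / t` is what makes `s ^ (2 * r)` cancel against `(115 / s²) ^ r`, leaving
  -- `s ^ s` to compare with `s!`.
  have hpow : ((s : ℝ) ^ (2 - (s : ℝ) / (t : ℝ))) ^ t = (s : ℝ) ^ (s + 2 * r) := by
    rw [← Real.rpow_mul_natCast hs0.le, ← Real.rpow_natCast]
    congr 1
    rw [sub_mul, div_mul_cancel₀ _ ht0.ne', ht]
    push_cast
    ring
  have h1 : (2 * m / 2 ^ s) ^ t ≤ (1 / 5000) ^ t * (s : ℝ) ^ (s + 2 * r) * (t : ℝ) ^ t := by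
    rw [← hpow, ← mul_pow, ← mul_pow]
    refine pow_le_pow_left₀ (by positivity) ?_ t
    rw [div_le_iff₀ (by positivity)]
    linarith
  have h2 : 2 * ((2 * m / 2 ^ s) ^ t * (115 / (s : ℝ) ^ 2) ^ r) ≤
      2 * ((1 / 5000) ^ t * 115 ^ t * Real.exp 1 ^ t * Real.exp 1 ^ t) *
        (s.factorial * t.factorial) := by
    have h115 : (115 : ℝ) ^ r ≤ 115 ^ t := pow_le_pow_right₀ (by norm_num) (by omega)
    have hexp : Real.exp 1 ^ s ≤ Real.exp 1 ^ t :=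
      pow_le_pow_right₀ (Real.one_le_exp zero_le_one) hst
    calc _ ≤ 2 * ((1 / 5000) ^ t * (s : ℝ) ^ (s + 2 * r) * (t : ℝ) ^ t *
          (115 / (s : ℝ) ^ 2) ^ r) := by gcongr
      _ = 2 * ((1 / 5000) ^ t * 115 ^ r * (s : ℝ) ^ s * (t : ℝ) ^ t) := by
          rw [div_pow 115, pow_add (s : ℝ), pow_mul]
          field_simp
      _ ≤ 2 * ((1 / 5000) ^ t * 115 ^ t * (Real.exp 1 ^ t * s.factorial) *
          (Real.exp 1 ^ t * t.factorial)) := by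
          gcongr
          · exact (pow_self_le_exp_mul_factorial s).trans (by gcongr)
          · exact pow_self_le_exp_mul_factorial t
      _ = _ := by ring
  have h3 : 2 * ((1 / 5000) ^ t * 115 ^ t * Real.exp 1 ^ t * Real.exp 1 ^ t) < 1 := by
    rw [← mul_pow, ← mul_pow, ← mul_pow]
    have he := Real.exp_one_lt_d9
    have he0 := Real.exp_pos 1
    -- The value is about 0.17; being below `1 / 2`, its `t`-th power absorbs the leading 2.
    have hb : 1 / 5000 * 115 * Real.exp 1 * Real.exp 1 < 1 / 2 := by nlinarith
    have := pow_le_of_le_one (n := t) (by positivity) (hb.le.trans (by norm_num)) (by omega)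
    linarith
  have hf : (0 : ℝ) < s.factorial * t.factorial := by positivity
  nlinarith

theorem mainTheorem1 :
    (∃ c : ℝ, 0 < c ∧ ∀ s t : ℕ, 1 ≤ s → s ≤ t →
      c * ((s : ℝ) ^ (2 - (s : ℝ) / (t : ℝ)) * (t : ℝ) * (2 : ℝ) ^ s) ≤
        (sizeRamsey (completeBipartiteGraph (Fin s) (Fin t)) : ℝ)) ∧
    (∀ s t : ℕ, 1 ≤ s → s + 2 ≤ t →
      (s : ℝ) ^ (2 - (s : ℝ) / (t : ℝ)) * (t : ℝ) * (2 : ℝ) ^ s / 10000 ≤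
        (sizeRamsey (completeBipartiteGraph (Fin s) (Fin t)) : ℝ)) := by
  refine ⟨⟨1 / 10000, by norm_num, fun s t hs hst => ?_⟩, fun s t hs hst => ?_⟩
  · rw [one_div_mul_eq_div]
    exact le_sizeRamsey_completeBipartiteGraph s t hs hst
  · exact le_sizeRamsey_completeBipartiteGraph s t hs (by omega)
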